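/- Theorem. Let $N\ge 1$, let $\Omega\subset\mathbb{R}^N$ be a bounded open set, and let $c>0$. There is a constant $C>0$, depending only on $\Omega$ and $c$, such that the following holds. Let $\Phi:\mathbb{R}^N\to\mathbb{R}^N$ be a $\mathcal C^2$-mapping such that, for some constant $M$, $$|\nabla\Phi(\mathbf a)|\le M,\qquad (\Phi(\mathbf a_1)-\Phi(\mathbf a_0))\cdot(\mathbf a_1-\mathbf a_0)\ge c\,|\mathbf a_1-\mathbf a_0|^2$$ for all $\mathbf a,\mathbf a_1,\mathbf a_0\in\mathbb{R}^N$. Then for every $u_0\in H^1(\Omega)$ there is a unique weak solution $u$ of $$\operatorname{div}[\Phi(\nabla u)]=0\ \text{ in }\Omega,\qquad u-u_0\in H^1_0(\Omega),$$ that is, a unique $u\in u_0+H^1_0(\Omega)$ with $\int_\Omega\Phi(\nabla u)\cdot\nabla w\,d\mathbf x=0$ for all $w\in H^1_0(\Omega)$. Moreover, $$\|u-v\|_{H^1(\Omega)}^2\le C\,E(v)\quad\text{for every } v\in u_0+H^1_0(\Omega),$$ where $$E(v)=\tfrac12\bigl\|\operatorname{div}[\Phi(\nabla v)]\bigr\|_{H^{-1}(\Omega)}^2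 .$$ Here $H^1_0(\Omega)$ is the closure of $C_c^\infty(\Omega)$ in $H^1(\Omega)$, $\|w\|_{H^1(\Omega)}^2=\|w\|_{L^2(\Omega)}^2+\|\nabla w\|_{L^2(\Omega)}^2$, and $$\bigl\|\operatorname{div}[\Phi(\nabla v)]\bigr\|_{H^{-1}(\Omega)}=\sup\Bigl\{\Bigl|\int_\Omega\Phi(\nabla v)\cdot\nabla w\,d\mathbf x\Bigr| : w\in H^1_0(\Omega),\ \|\nabla w\|_{L^2(\Omega)}\le 1\Bigr\}.$$ -/

import Mathlib

open MeasureTheory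
open scoped ContDiff RealInnerProductSpace

noncomputable section

/-- The Euclidean space `ℝ^N`. -/
abbrev RN (N : ℕ) : Type := EuclideanSpace ℝ (Fin N)

/-- Test functions: the elements of `C_c^∞(Ω)`. -/
structure IsTestFunction {N : ℕ} (Ω : Set (RN N)) (φ : RN N → ℝ) : Prop where
  smooth : ContDiff ℝ ∞ φ
  compact : HasCompactSupport φ
  subset : tsupport φ ⊆ Ω

/-- The Hilbert space `L²(Ω) × L²(Ω; ℝ^N)`, with norm `(‖u‖² + ‖g‖²)^{1/2}`. -/
abbrev L2Pair {N : ℕ} (Ω : Set (RN N)) : Type :=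
  WithLp 2 (Lp ℝ 2 (volume.restrict Ω) × Lp (RN N) 2 (volume.restrict Ω))

/-- `g` is the weak gradient of `u` in `Ω`: `∫_Ω u ∂ᵢφ = - ∫_Ω gᵢ φ` for all test functions `φ`
and all coordinates `i`. -/
def IsWeakGradient {N : ℕ} (Ω : Set (RN N)) (u : RN N → ℝ) (g : RN N → RN N) : Prop :=
  ∀ φ : RN N → ℝ, IsTestFunction Ω φ → ∀ i : Fin N,
    ∫ x in Ω, u x * fderiv ℝ φ x (EuclideanSpace.single i 1) = - ∫ x in Ω, g x i * φ x

theorem IsTestFunction.memLp {N : ℕ} {Ω : Set (RN N)} {φ : RN N → ℝ} (h : IsTestFunction Ω φ) :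
    MemLp φ 2 (volume.restrict Ω) :=
  (h.smooth.continuous.memLp_of_hasCompactSupport h.compact).restrict Ω

theorem IsTestFunction.memLp_fderiv {N : ℕ} {Ω : Set (RN N)} {φ : RN N → ℝ}
    (h : IsTestFunction Ω φ) (e : RN N) :
    MemLp (fun x => fderiv ℝ φ x e) 2 (volume.restrict Ω) := by
  have hc : Continuous (fun x => fderiv ℝ φ x e) :=
    (h.smooth.continuous_fderiv (by simp)).clm_apply continuous_const
  exact (hc.memLp_of_hasCompactSupport (h.compact.fderiv_apply ℝ e)).restrict Ω

theorem memLp_coord {N : ℕ} {Ω : Set (RN N)} (g : Lp (RN N) 2 (volume.restrict Ω)) (i : Fin N) :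
    MemLp (fun x => g x i) 2 (volume.restrict Ω) :=
  (EuclideanSpace.proj (𝕜 := ℝ) i).comp_memLp' (Lp.memLp g)

/-- The Sobolev space `H¹(Ω)`, as the space of pairs `(u, ∇u)` with `u ∈ L²(Ω)` whose weak gradient
`∇u` is in `L²(Ω; ℝ^N)` (for open `Ω` the function `u` determines `∇u`). The norm is the usual one,
`‖u‖²_{H¹} = ‖u‖²_{L²} + ‖∇u‖²_{L²}`. -/
def SobolevH1 {N : ℕ} (Ω : Set (RN N)) : Submodule ℝ (L2Pair Ω) where
  carrier := {p | IsWeakGradient Ω p.fst p.snd}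
  zero_mem' := by
    intro φ hφ i
    have h1 : (fun x => ((0 : L2Pair Ω).fst) x * fderiv ℝ φ x (EuclideanSpace.single i 1))
        =ᵐ[volume.restrict Ω] fun _ => 0 := by
      filter_upwards [Lp.coeFn_zero ℝ 2 (volume.restrict Ω)] with x hx
      rw [WithLp.zero_fst, hx]
      simp
    have h2 : (fun x => ((0 : L2Pair Ω).snd) x i * φ x)
        =ᵐ[volume.restrict Ω] fun _ => 0 := by
      filter_upwards [Lp.coeFn_zero (RN N) 2 (volume.restrict Ω)] with x hx
      rw [WithLp.zero_snd, hx]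
      simp
    rw [integral_congr_ae h1, integral_congr_ae h2]
    simp
  add_mem' := by
    intro p q hp hq φ hφ i
    have h1 : (fun x => ((p + q).fst) x * fderiv ℝ φ x (EuclideanSpace.single i 1))
        =ᵐ[volume.restrict Ω] fun x => p.fst x * fderiv ℝ φ x (EuclideanSpace.single i 1)
          + q.fst x * fderiv ℝ φ x (EuclideanSpace.single i 1) := by
      filter_upwards [Lp.coeFn_add p.fst q.fst] with x hx
      rw [WithLp.add_fst, hx]
      simp [add_mul]
    have h2 : (fun x => ((p + q).snd) x i * φ x)
        =ᵐ[volume.restrict Ω] fun x => p.snd x i * φ x + q.snd x i * φ x := by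
      filter_upwards [Lp.coeFn_add p.snd q.snd] with x hx
      rw [WithLp.add_snd, hx]
      simp [add_mul]
    have h3 := integral_add
      ((Lp.memLp p.fst).integrable_mul (hφ.memLp_fderiv (EuclideanSpace.single i 1)))
      ((Lp.memLp q.fst).integrable_mul (hφ.memLp_fderiv (EuclideanSpace.single i 1)))
    have h4 := integral_add ((memLp_coord p.snd i).integrable_mul hφ.memLp)
      ((memLp_coord q.snd i).integrable_mul hφ.memLp)
    simp only [Pi.mul_apply] at h3 h4
    rw [integral_congr_ae h1, integral_congr_ae h2, h3, h4, hp φ hφ i, hq φ hφ i]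
    ring
  smul_mem' := by
    intro c p hp φ hφ i
    have h1 : (fun x => ((c • p).fst) x * fderiv ℝ φ x (EuclideanSpace.single i 1))
        =ᵐ[volume.restrict Ω]
          fun x => c * (p.fst x * fderiv ℝ φ x (EuclideanSpace.single i 1)) := by
      filter_upwards [Lp.coeFn_smul c p.fst] with x hx
      rw [WithLp.smul_fst, hx]
      simp [mul_assoc]
    have h2 : (fun x => ((c • p).snd) x i * φ x)
        =ᵐ[volume.restrict Ω] fun x => c * (p.snd x i * φ x) := by
      filter_upwards [Lp.coeFn_smul c p.snd] with x hx
      rw [WithLp.smul_snd, hx]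
      simp [mul_assoc]
    rw [integral_congr_ae h1, integral_congr_ae h2, integral_const_mul, integral_const_mul,
      hp φ hφ i]
    ring

/-- The weak gradient `∇u ∈ L²(Ω; ℝ^N)` of `u ∈ H¹(Ω)`. -/
def weakGrad {N : ℕ} {Ω : Set (RN N)} (u : SobolevH1 Ω) : Lp (RN N) 2 (volume.restrict Ω) :=
  (u : L2Pair Ω).snd

/-- `C_c^∞(Ω)` as a subspace of `H¹(Ω)`. -/
def testH1 {N : ℕ} (Ω : Set (RN N)) : Submodule ℝ (SobolevH1 Ω) where
  carrier := {u | ∃ φ : RN N → ℝ, IsTestFunction Ω φ ∧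
    (u : L2Pair Ω).fst =ᵐ[volume.restrict Ω] φ ∧ weakGrad u =ᵐ[volume.restrict Ω] gradient φ}
  zero_mem' := by
    refine ⟨fun _ => 0, ⟨contDiff_const, HasCompactSupport.zero, ?_⟩,
      Lp.coeFn_zero ℝ 2 (volume.restrict Ω), ?_⟩
    · have : tsupport (fun _ : RN N => (0 : ℝ)) = ∅ := tsupport_eq_empty_iff.2 rfl
      simp [this]
    · filter_upwards [Lp.coeFn_zero (RN N) 2 (volume.restrict Ω)] with x hx
      have : weakGrad (0 : SobolevH1 Ω) = 0 := rfl
      rw [this, hx]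
      simp [gradient]
  add_mem' := by
    rintro u v ⟨φ, hφ, hu, hu'⟩ ⟨ψ, hψ, hv, hv'⟩
    refine ⟨fun x => φ x + ψ x, ⟨hφ.smooth.add hψ.smooth, hφ.compact.add hψ.compact,
      (tsupport_add φ ψ).trans (Set.union_subset hφ.subset hψ.subset)⟩, ?_, ?_⟩
    · filter_upwards [Lp.coeFn_add (u : L2Pair Ω).fst (v : L2Pair Ω).fst, hu, hv] with x hx h1 h2
      have : ((u + v : SobolevH1 Ω) : L2Pair Ω).fst = (u : L2Pair Ω).fst + (v : L2Pair Ω).fst := rfl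
      rw [this, hx, Pi.add_apply, h1, h2]
    · filter_upwards [Lp.coeFn_add (weakGrad u) (weakGrad v), hu', hv'] with x hx h1 h2
      have hd : fderiv ℝ (fun x => φ x + ψ x) x = fderiv ℝ φ x + fderiv ℝ ψ x :=
        fderiv_fun_add ((hφ.smooth.differentiable (by simp)) x)
          ((hψ.smooth.differentiable (by simp)) x)
      have : weakGrad (u + v) = weakGrad u + weakGrad v := rfl
      rw [this, hx, Pi.add_apply, h1, h2]
      simp [gradient, hd]
  smul_mem' := by
    rintro c u ⟨φ, hφ, hu, hu'⟩
    refine ⟨fun x => c * φ x, ⟨contDiff_const.mul hφ.smooth, hφ.compact.mul_left,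
      (tsupport_mul_subset_right (f := fun _ => c) (g := φ)).trans hφ.subset⟩, ?_, ?_⟩
    · filter_upwards [Lp.coeFn_smul c (u : L2Pair Ω).fst, hu] with x hx h1
      have : ((c • u : SobolevH1 Ω) : L2Pair Ω).fst = c • (u : L2Pair Ω).fst := rfl
      rw [this, hx, Pi.smul_apply, h1, smul_eq_mul]
    · filter_upwards [Lp.coeFn_smul c (weakGrad u), hu'] with x hx h1
      have hd : fderiv ℝ (fun x => c * φ x) x = c • fderiv ℝ φ x :=
        fderiv_const_mul ((hφ.smooth.differentiable (by simp)) x) c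
      have : weakGrad (c • u) = c • weakGrad u := rfl
      rw [this, hx, Pi.smul_apply, h1]
      simp [gradient, hd]

/-- `H¹₀(Ω)`, the closure of `C_c^∞(Ω)` in `H¹(Ω)`. -/
def SobolevH10 {N : ℕ} (Ω : Set (RN N)) : Submodule ℝ (SobolevH1 Ω) :=
  (testH1 Ω).topologicalClosure

/-- The functional `div F` on `H¹₀(Ω)`: `⟨div F, w⟩ = - ∫_Ω F · ∇w`. -/
def weakDiv {N : ℕ} {Ω : Set (RN N)} (F : RN N → RN N) (w : SobolevH10 Ω) : ℝ :=
  - ∫ x in Ω, ⟪F x, weakGrad (w : SobolevH1 Ω) x⟫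

/-- `u` is a weak solution of `div Φ(∇u) = 0` in `Ω`. -/
def IsWeakSolution {N : ℕ} {Ω : Set (RN N)} (Φ : RN N → RN N) (u : SobolevH1 Ω) : Prop :=
  ∀ w : SobolevH10 Ω, weakDiv (fun x => Φ (weakGrad u x)) w = 0

/-- The norm of `H⁻¹(Ω)`, dual to the norm `‖∇w‖_{L²(Ω)}` of `H¹₀(Ω)`. -/
def hMinusOneNorm {N : ℕ} {Ω : Set (RN N)} (T : SobolevH10 Ω → ℝ) : ℝ :=
  sSup {r : ℝ | ∃ w : SobolevH10 Ω, ‖weakGrad (w : SobolevH1 Ω)‖ ≤ 1 ∧ r = |T w|}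

/-- The error functional `E(v) = ½ ‖div Φ(∇v)‖²_{H⁻¹(Ω)}`. -/
def errorFunctional {N : ℕ} {Ω : Set (RN N)} (Φ : RN N → RN N) (v : SobolevH1 Ω) : ℝ :=
  1 / 2 * hMinusOneNorm (weakDiv (Ω := Ω) (fun x => Φ (weakGrad v x))) ^ 2

end

/-! Write `u = u₀ + w` and let `A` be the map of H¹₀(Ω) into itself that represents `z ↦ ∫ Φ(∇u₀ +
∇w)·∇z`. The bound `M` on `∇Φ` makes `A` Lipschitz; monotonicity of `Φ` together with the Poincaré
inequality makes it strongly monotone. Then `w ↦ w - t A w` is a contraction for small `t > 0`, and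
its fixed point is the solution (`exists_eq_zero_of_lipschitz_of_strongly_monotone`).

For the estimate, monotonicity and the equation for `u` tested with `u - v` give `c‖∇(u - v)‖² ≤ -∫
Φ(∇v)·∇(u - v) ≤ ‖div Φ(∇v)‖ ‖∇(u - v)‖`, and Poincaré (`norm_sq_le_weakGrad_of_mem_SobolevH10`)
passes to the H¹ norm. The Lipschitz constant does not enter the resulting constant, so `C` is
independent of `M`. Uniqueness is the case `E(u') = 0`. -/

noncomputable section

/-! ### Strongly monotone equations in Hilbert space -/

/-- **Zarantonello's theorem**: a Lipschitz, strongly monotone map of a real Hilbert space into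
itself has a zero. -/
theorem exists_eq_zero_of_lipschitz_of_strongly_monotone {V : Type*} [NormedAddCommGroup V]
    [InnerProductSpace ℝ V] [CompleteSpace V] (A : V → V) {m L : ℝ} (hm : 0 < m)
    (hL : ∀ x y, ‖A x - A y‖ ≤ L * ‖x - y‖)
    (hA : ∀ x y, m * ‖x - y‖ ^ 2 ≤ ⟪A x - A y, x - y⟫) : ∃ x, A x = 0 := by
  obtain ⟨B, hB0, hLB, hmB⟩ : ∃ B : ℝ, 0 < B ∧ L ≤ B ∧ m ≤ B :=
    ⟨max L m, lt_max_of_lt_right hm, le_max_left _ _, le_max_right _ _⟩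
  -- This `t` minimizes the squared contraction factor `1 - 2tm + t²B²`, with minimum `1 - mt`.
  -- Enlarging `L` to `B ≥ m` keeps `B` positive and `1 - mt` nonnegative.
  set t : ℝ := m / B ^ 2 with ht
  have ht0 : 0 < t := by positivity
  have hq0 : 0 ≤ 1 - m * t := by
    rw [ht, sub_nonneg, ← mul_div_assoc, div_le_one (by positivity)]
    nlinarith
  have hq1 : 1 - m * t < 1 := by nlinarith [mul_pos hm ht0]
  have htB : t * B ^ 2 = m := by rw [ht]; field_simp
  have hbound : ∀ x y, ‖(x - t • A x) - (y - t • A y)‖ ^ 2 ≤ (1 - m * t) * ‖x - y‖ ^ 2 := by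
    intro x y
    have h1 : (x - t • A x) - (y - t • A y) = (x - y) - t • (A x - A y) := by
      rw [smul_sub]; abel
    have h2 : ‖A x - A y‖ ^ 2 ≤ B ^ 2 * ‖x - y‖ ^ 2 := by
      rw [← mul_pow]
      exact pow_le_pow_left₀ (norm_nonneg _) ((hL x y).trans (by gcongr)) 2
    rw [h1, norm_sub_sq_real, inner_smul_right, norm_smul, mul_pow, Real.norm_eq_abs, sq_abs,
      real_inner_comm]
    have h3 := mul_le_mul_of_nonneg_left (hA x y) ht0.le
    have h4 := mul_le_mul_of_nonneg_left h2 (sq_nonneg t)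
    have h5 : t ^ 2 * (B ^ 2 * ‖x - y‖ ^ 2) = t * (m * ‖x - y‖ ^ 2) := by
      rw [← htB]; ring
    linarith
  have hf : ContractingWith (Real.toNNReal √(1 - m * t)) (fun x => x - t • A x) := by
    refine ⟨?_, LipschitzWith.of_dist_le_mul fun x y => ?_⟩
    · rw [← NNReal.coe_lt_coe, Real.coe_toNNReal _ (Real.sqrt_nonneg _), NNReal.coe_one,
        Real.sqrt_lt' one_pos]
      simpa using hq1
    · rw [Real.coe_toNNReal _ (Real.sqrt_nonneg _), dist_eq_norm, dist_eq_norm]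
      refine (sq_le_sq₀ (norm_nonneg _) (by positivity)).1 ?_
      rw [mul_pow, Real.sq_sqrt hq0]
      exact hbound x y
  refine ⟨hf.fixedPoint, ?_⟩
  have h := hf.fixedPoint_isFixedPt
  rw [Function.IsFixedPt, sub_eq_self, smul_eq_zero] at h
  exact h.resolve_left ht0.ne'

/-- The equation `D† G (g₀ + D w) = 0` is solvable for a Lipschitz, strongly monotone `G` and a
linear map `D` that is bounded below. -/
theorem exists_inner_map_eq_zero {V H : Type*} [NormedAddCommGroup V] [InnerProductSpace ℝ V]
    [CompleteSpace V] [NormedAddCommGroup H] [InnerProductSpace ℝ H] [CompleteSpace H]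
    (D : V →L[ℝ] H) (G : H → H) (g₀ : H) {c P K : ℝ} (hc : 0 < c) (hP : 0 < P) (hK : 0 ≤ K)
    (hG : ∀ f g, ‖G f - G g‖ ≤ K * ‖f - g‖)
    (hmono : ∀ f g, c * ‖f - g‖ ^ 2 ≤ ⟪G f - G g, f - g⟫)
    (hD : ∀ w, ‖w‖ ^ 2 ≤ P * ‖D w‖ ^ 2) :
    ∃ w, ∀ z, ⟪G (g₀ + D w), D z⟫ = 0 := by
  have hsub : ∀ x y, (g₀ + D x) - (g₀ + D y) = D (x - y) := fun x y => by
    rw [map_sub, add_sub_add_left_eq_sub]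
  obtain ⟨w, hw⟩ := exists_eq_zero_of_lipschitz_of_strongly_monotone
    (fun w => D.adjoint (G (g₀ + D w)))
    (m := c / P) (L := ‖D.adjoint‖ * (K * ‖D‖)) (by positivity)
    (fun x y => by
      rw [← map_sub, mul_assoc, mul_assoc]
      refine (D.adjoint.le_opNorm _).trans ?_
      gcongr
      refine (hG _ _).trans ?_
      rw [hsub]
      gcongr
      exact D.le_opNorm _)
    (fun x y => by
      rw [← map_sub, ContinuousLinearMap.adjoint_inner_left, ← hsub]
      refine le_trans ?_ (hmono _ _)
      rw [hsub, div_mul_eq_mul_div, mul_div_assoc]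
      gcongr
      rw [div_le_iff₀' hP]
      exact hD _)
  exact ⟨w, fun z => by
    rw [← ContinuousLinearMap.adjoint_inner_left, hw, inner_zero_left]⟩

/-- The equation `⟪G (g₀ + D w), D z⟫ = 0` for all `z` in a closed subspace `W` has a solution
`w ∈ W`, for a Lipschitz, strongly monotone `G` and a linear map `D` bounded below on `W`. -/
theorem exists_mem_inner_map_eq_zero {V H : Type*} [NormedAddCommGroup V]
    [InnerProductSpace ℝ V] [CompleteSpace V] [NormedAddCommGroup H] [InnerProductSpace ℝ H]
    [CompleteSpace H] (D : V →L[ℝ] H) (W : Submodule ℝ V) (hW : IsClosed (W : Set V))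
    (G : H → H) (g₀ : H) {c P K : ℝ} (hc : 0 < c) (hP : 0 < P) (hK : 0 ≤ K)
    (hG : ∀ f g, ‖G f - G g‖ ≤ K * ‖f - g‖)
    (hmono : ∀ f g, c * ‖f - g‖ ^ 2 ≤ ⟪G f - G g, f - g⟫)
    (hD : ∀ w ∈ W, ‖w‖ ^ 2 ≤ P * ‖D w‖ ^ 2) :
    ∃ w ∈ W, ∀ z ∈ W, ⟪G (g₀ + D w), D z⟫ = 0 := by
  have : CompleteSpace W := hW.completeSpace_coe
  obtain ⟨w, hw⟩ := exists_inner_map_eq_zero (D.comp W.subtypeL) G g₀ hc hP hK hG hmono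
    (fun w => hD w w.2)
  exact ⟨w, w.2, fun z hz => hw ⟨z, hz⟩⟩

/-! ### H¹(Ω) as a Hilbert space -/

variable {N : ℕ} {Ω : Set (RN N)}

/-- For fixed `φ` and `i`, both sides of the weak gradient identity are L² inner products with fixed
functions, `∂ᵢφ` and the vector field `φ eᵢ`. Each identity is therefore a closed condition on the
pair. -/
theorem isClosed_SobolevH1 (Ω : Set (RN N)) : IsClosed (SobolevH1 Ω : Set (L2Pair Ω)) := by
  have hset : (SobolevH1 Ω : Set (L2Pair Ω)) = ⋂ (φ : RN N → ℝ) (hφ : IsTestFunction Ω φ)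
      (i : Fin N), {p : L2Pair Ω |
        ⟪p.fst, (hφ.memLp_fderiv (EuclideanSpace.single i 1)).toLp⟫
          = - ⟪p.snd, (((ContinuousLinearMap.toSpanSingleton ℝ
              (EuclideanSpace.single i 1 : RN N)).comp_memLp' hφ.memLp)).toLp⟫} := by
    ext p
    simp only [Set.mem_iInter, Set.mem_ofPred_eq]
    refine forall_congr' fun φ => forall_congr' fun hφ => forall_congr' fun i => ?_
    rw [L2.inner_def, L2.inner_def]
    have h1 : ∫ x in Ω, ⟪p.fst x, (hφ.memLp_fderiv (EuclideanSpace.single i 1)).toLp _ x⟫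
        = ∫ x in Ω, p.fst x * fderiv ℝ φ x (EuclideanSpace.single i 1) := by
      refine integral_congr_ae ?_
      filter_upwards [(hφ.memLp_fderiv (EuclideanSpace.single i 1)).coeFn_toLp] with x hx
      rw [hx]
      simp [mul_comm]
    have h2 : ∫ x in Ω, ⟪p.snd x, (((ContinuousLinearMap.toSpanSingleton ℝ
        (EuclideanSpace.single i 1 : RN N)).comp_memLp' hφ.memLp)).toLp _ x⟫
        = ∫ x in Ω, p.snd x i * φ x := by
      refine integral_congr_ae ?_
      filter_upwards [((ContinuousLinearMap.toSpanSingleton ℝ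
        (EuclideanSpace.single i 1 : RN N)).comp_memLp' hφ.memLp).coeFn_toLp] with x hx
      rw [hx]
      simp [inner_smul_right, EuclideanSpace.inner_single_right, mul_comm]
    rw [h1, h2]
  rw [hset]
  refine isClosed_iInter fun φ => isClosed_iInter fun hφ => isClosed_iInter fun i => ?_
  refine isClosed_eq ?_ ?_
  · exact (WithLp.continuous_fst 2 _ _).inner continuous_const
  · exact ((WithLp.continuous_snd 2 _ _).inner continuous_const).neg

instance : CompleteSpace (SobolevH1 Ω) := (isClosed_SobolevH1 Ω).completeSpace_coe

theorem norm_sq_SobolevH1 (u : SobolevH1 Ω) :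
    ‖u‖ ^ 2 = ‖(u : L2Pair Ω).fst‖ ^ 2 + ‖weakGrad u‖ ^ 2 :=
  WithLp.prod_norm_sq_eq_of_L2 (u : L2Pair Ω)

theorem norm_weakGrad_le (u : SobolevH1 Ω) : ‖weakGrad u‖ ≤ ‖u‖ := by
  refine (sq_le_sq₀ (norm_nonneg _) (norm_nonneg u)).1 ?_
  rw [norm_sq_SobolevH1 u]
  exact le_add_of_nonneg_left (sq_nonneg _)

/-- The weak gradient as a continuous linear map on `H¹(Ω)`. -/
def weakGradL (Ω : Set (RN N)) : SobolevH1 Ω →L[ℝ] Lp (RN N) 2 (volume.restrict Ω) :=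
  LinearMap.mkContinuous ⟨⟨weakGrad, fun _ _ => rfl⟩, fun _ _ => rfl⟩ 1 fun u => by
    rw [one_mul]
    exact norm_weakGrad_le u

/-! ### The Poincaré inequality -/

/-- The Poincaré inequality for a test function. -/
theorem IsTestFunction.integral_sq_le {φ : RN N → ℝ} (hφ : IsTestFunction Ω φ) {R : ℝ}
    (hR : ∀ x ∈ Ω, ‖x‖ ≤ R) (i : Fin N) :
    ∫ x in Ω, φ x ^ 2 ≤ 4 * R ^ 2 * ∫ x in Ω, ‖gradient φ x‖ ^ 2 := by
  set e : RN N := EuclideanSpace.single i 1 with he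
  have hd : Differentiable ℝ φ := hφ.smooth.differentiable (by simp)
  have hc : Continuous φ := hφ.smooth.continuous
  have hc' : Continuous (fderiv ℝ φ) := hφ.smooth.continuous_fderiv (by simp)
  have hce : Continuous fun x => fderiv ℝ φ x e := hc'.clm_apply continuous_const
  have hgc : Continuous (gradient φ) :=
    (InnerProductSpace.toDual ℝ (RN N)).symm.continuous.comp hc'
  have hzero : ∀ x, x ∉ Ω → φ x = 0 := fun x hx =>
    image_eq_zero_of_notMem_tsupport fun h => hx (hφ.subset h)
  have hzero' : ∀ x, x ∉ Ω → gradient φ x = 0 := fun x hx => by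
    rw [gradient, image_eq_zero_of_notMem_tsupport
      (fun h => hx (hφ.subset (tsupport_fderiv_subset ℝ h))), map_zero]
  have hpr : ∀ x, fderiv ℝ (fun y : RN N => y i) x e = 1 := by
    intro x
    have : fderiv ℝ (fun y : RN N => y i) x = EuclideanSpace.proj (𝕜 := ℝ) i :=
      (EuclideanSpace.proj (𝕜 := ℝ) i).fderiv
    rw [this, he]
    simp
  have hsq : ∀ x, fderiv ℝ (fun y => φ y ^ 2) x e = 2 * φ x * fderiv ℝ φ x e := by
    intro x
    rw [fderiv_fun_pow 2 (hd x)]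
    simp
  have hxi : Continuous fun x : RN N => x i := (EuclideanSpace.proj (𝕜 := ℝ) i).continuous
  have hS2 : HasCompactSupport fun x => φ x ^ 2 :=
    hφ.compact.comp_left (g := fun y : ℝ => y ^ 2) (by simp)
  have hI2 : Integrable fun x => φ x ^ 2 := (hc.pow 2).integrable_of_hasCompactSupport hS2
  have hI3 : Integrable fun x => 2 * φ x * fderiv ℝ φ x e * x i :=
    (((continuous_const.mul hc).mul hce).mul hxi).integrable_of_hasCompactSupport
      ((hφ.compact.mul_left.mul_right).mul_right)
  have hI4 : Integrable fun x => ‖gradient φ x‖ ^ 2 := by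
    refine (hgc.norm.pow 2).integrable_of_hasCompactSupport ?_
    refine HasCompactSupport.intro hφ.compact fun x hx => ?_
    have h0 : fderiv ℝ φ x = 0 :=
      image_eq_zero_of_notMem_tsupport fun h => hx (tsupport_fderiv_subset ℝ h)
    simp [gradient, h0]
  -- Integration by parts of `φ²` against the coordinate `xᵢ`, whose derivative along `e` is 1.
  have hibp : ∫ x, φ x ^ 2 = - ∫ x, 2 * φ x * fderiv ℝ φ x e * x i := by
    have h := integral_mul_fderiv_eq_neg_fderiv_mul_of_integrable (μ := volume)
      (f := fun x => φ x ^ 2) (g := fun x : RN N => x i) (v := e)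
      (by simpa only [hsq] using hI3) (by simpa only [hpr, mul_one] using hI2)
      (((hc.pow 2).mul hxi).integrable_of_hasCompactSupport hS2.mul_right)
      (fun x _ => (hd x).pow 2) (fun x _ => (EuclideanSpace.proj (𝕜 := ℝ) i).differentiableAt)
    simpa only [hsq, hpr, mul_one] using h
  rw [setIntegral_eq_integral_of_forall_compl_eq_zero (fun x hx => by simp [hzero x hx]),
    setIntegral_eq_integral_of_forall_compl_eq_zero (fun x hx => by simp [hzero' x hx])]
  have hle : - ∫ x, 2 * φ x * fderiv ℝ φ x e * x i
      ≤ ∫ x, (1 / 2 * φ x ^ 2 + 2 * R ^ 2 * ‖gradient φ x‖ ^ 2) := by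
    rw [← integral_neg]
    refine integral_mono hI3.neg ((hI2.const_mul _).add (hI4.const_mul _)) fun x => ?_
    by_cases hx : x ∈ Ω
    · have h1 : |fderiv ℝ φ x e| ≤ ‖gradient φ x‖ := by
        have h := (fderiv ℝ φ x).le_opNorm e
        rw [gradient, LinearIsometryEquiv.norm_map]
        simpa [he] using h
      have h2 : |x i| ≤ R := (PiLp.norm_apply_le x i).trans (hR x hx)
      have h3 : |fderiv ℝ φ x e * x i| ≤ ‖gradient φ x‖ * R := by
        rw [abs_mul]; gcongr
      have h4 : (fderiv ℝ φ x e * x i) ^ 2 ≤ (‖gradient φ x‖ * R) ^ 2 :=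
        sq_le_sq' (abs_le.1 h3).1 (abs_le.1 h3).2
      -- Young's inequality `-2φs ≤ φ²/2 + 2s²` with `s = xᵢ ∂ᵢφ`. The term `φ²/2` is absorbed on
      -- the left at the end, which doubles `2R²` to `4R²`.
      nlinarith [sq_nonneg (φ x + 2 * (fderiv ℝ φ x e * x i))]
    · simp [hzero x hx, hzero' x hx]
  rw [integral_add (hI2.const_mul _) (hI4.const_mul _), integral_const_mul,
    integral_const_mul, ← hibp] at hle
  linarith

theorem norm_sq_eq_integral {α E : Type*} [MeasurableSpace α] {μ : Measure α}
    [NormedAddCommGroup E] [InnerProductSpace ℝ E] (f : Lp E 2 μ) :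
    ‖f‖ ^ 2 = ∫ x, ‖f x‖ ^ 2 ∂μ := by
  rw [← real_inner_self_eq_norm_sq, L2.inner_def]
  simp only [real_inner_self_eq_norm_sq]

/-- The **Poincaré inequality** on `H¹₀(Ω)`, for `Ω` in a ball of radius `R`. -/
theorem norm_sq_le_weakGrad_of_mem_SobolevH10 (hN : 1 ≤ N) {R : ℝ} (hR : ∀ x ∈ Ω, ‖x‖ ≤ R)
    {w : SobolevH1 Ω} (hw : w ∈ SobolevH10 Ω) :
    ‖w‖ ^ 2 ≤ (4 * R ^ 2 + 1) * ‖weakGrad w‖ ^ 2 := by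
  have hclosed : IsClosed {w : SobolevH1 Ω |
      ‖w‖ ^ 2 ≤ (4 * R ^ 2 + 1) * ‖weakGrad w‖ ^ 2} :=
    isClosed_le (by fun_prop) (continuous_const.mul ((weakGradL Ω).continuous.norm.pow 2))
  -- Both sides are continuous in the H¹ norm, so test functions suffice. The `+ 1` in the constant
  -- accounts for the gradient part of the H¹ norm.
  refine closure_minimal ?_ hclosed hw
  rintro u ⟨φ, hφ, hu, hu'⟩
  have h := hφ.integral_sq_le hR ⟨0, hN⟩
  have h1 : ‖(u : L2Pair Ω).fst‖ ^ 2 = ∫ x in Ω, φ x ^ 2 := by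
    rw [norm_sq_eq_integral]
    refine integral_congr_ae ?_
    filter_upwards [hu] with x hx
    simp [hx]
  have h2 : ‖weakGrad u‖ ^ 2 = ∫ x in Ω, ‖gradient φ x‖ ^ 2 := by
    rw [norm_sq_eq_integral]
    refine integral_congr_ae ?_
    filter_upwards [hu'] with x hx
    rw [hx]
  rw [← h1, ← h2] at h
  change ‖u‖ ^ 2 ≤ (4 * R ^ 2 + 1) * ‖weakGrad u‖ ^ 2
  rw [norm_sq_SobolevH1 u]
  linarith

/-! ### The superposition operator and the dual norm -/

/-- `Φ - Φ 0` is Lipschitz and fixes 0, so it preserves Lᵖ; the constant `Φ 0` is in Lᵖ because the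
measure is finite. -/
theorem LipschitzWith.memLp_comp_of_isFiniteMeasure {α E F : Type*} [MeasurableSpace α]
    {μ : Measure α} [IsFiniteMeasure μ] [NormedAddCommGroup E] [NormedAddCommGroup F]
    {p : ENNReal} {K : NNReal} {Φ : E → F} (hΦ : LipschitzWith K Φ) {f : α → E}
    (hf : MemLp f p μ) : MemLp (fun x => Φ (f x)) p μ := by
  have h1 : LipschitzWith K fun a => Φ a - Φ 0 := fun a b => by
    simpa using hΦ a b
  have h2 := (h1.comp_memLp (by simp) hf).add (memLp_const (Φ 0))
  refine h2.congr_norm ?_ ?_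
  · exact hΦ.continuous.comp_aestronglyMeasurable hf.aestronglyMeasurable
  · exact Filter.Eventually.of_forall fun x => by simp

section Superposition

variable [IsFiniteMeasure (volume.restrict Ω)] {K : NNReal} {Φ : RN N → RN N}

/-- The superposition operator `g ↦ Φ ∘ g` on `L²(Ω; ℝ^N)`. -/
def superposition (hΦ : LipschitzWith K Φ) (g : Lp (RN N) 2 (volume.restrict Ω)) :
    Lp (RN N) 2 (volume.restrict Ω) :=
  (hΦ.memLp_comp_of_isFiniteMeasure (Lp.memLp g)).toLp

theorem coeFn_superposition (hΦ : LipschitzWith K Φ) (g : Lp (RN N) 2 (volume.restrict Ω)) :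
    superposition hΦ g =ᵐ[volume.restrict Ω] fun x => Φ (g x) :=
  MemLp.coeFn_toLp _

theorem norm_superposition_sub_le (hΦ : LipschitzWith K Φ)
    (f g : Lp (RN N) 2 (volume.restrict Ω)) :
    ‖superposition hΦ f - superposition hΦ g‖ ≤ K * ‖f - g‖ := by
  refine Lp.norm_le_mul_norm_of_ae_le_mul ?_
  filter_upwards [coeFn_superposition hΦ f, coeFn_superposition hΦ g,
    Lp.coeFn_sub (superposition hΦ f) (superposition hΦ g), Lp.coeFn_sub f g] with x h1 h2 h3 h4
  rw [h3, h4, Pi.sub_apply, Pi.sub_apply, h1, h2, ← dist_eq_norm, ← dist_eq_norm]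
  exact hΦ.dist_le_mul _ _

theorem le_inner_superposition_sub (hΦ : LipschitzWith K Φ) {c : ℝ}
    (hmono : ∀ a₁ a₀, c * ‖a₁ - a₀‖ ^ 2 ≤ ⟪Φ a₁ - Φ a₀, a₁ - a₀⟫)
    (f g : Lp (RN N) 2 (volume.restrict Ω)) :
    c * ‖f - g‖ ^ 2 ≤ ⟪superposition hΦ f - superposition hΦ g, f - g⟫ := by
  rw [norm_sq_eq_integral, L2.inner_def, ← integral_const_mul]
  refine integral_mono_ae ?_ (L2.integrable_inner _ _) ?_
  · have h := L2.integrable_inner (𝕜 := ℝ) (f - g) (f - g)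
    simp only [real_inner_self_eq_norm_sq] at h
    exact h.const_mul c
  · filter_upwards [coeFn_superposition hΦ f, coeFn_superposition hΦ g,
      Lp.coeFn_sub (superposition hΦ f) (superposition hΦ g), Lp.coeFn_sub f g] with x h1 h2 h3 h4
    rw [h3, h4, Pi.sub_apply, Pi.sub_apply, h1, h2]
    exact hmono _ _

theorem weakDiv_eq_neg_inner_superposition (hΦ : LipschitzWith K Φ)
    (g : Lp (RN N) 2 (volume.restrict Ω)) (w : SobolevH10 Ω) :
    weakDiv (fun x => Φ (g x)) w = - ⟪superposition hΦ g, weakGrad (w : SobolevH1 Ω)⟫ := by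
  rw [weakDiv, L2.inner_def]
  refine congrArg _ (integral_congr_ae ?_)
  filter_upwards [coeFn_superposition hΦ g] with x hx
  rw [hx]

theorem abs_weakDiv_le_hMinusOneNorm_mul (hΦ : LipschitzWith K Φ)
    (g : Lp (RN N) 2 (volume.restrict Ω)) (w : SobolevH10 Ω) :
    |weakDiv (fun x => Φ (g x)) w|
      ≤ hMinusOneNorm (weakDiv (Ω := Ω) (fun x => Φ (g x))) * ‖weakGrad (w : SobolevH1 Ω)‖ := by
  -- A real `sSup` dominates the elements of its set only if the set is bounded above;
  -- Cauchy–Schwarz supplies the bound.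
  have hbdd : BddAbove {r : ℝ | ∃ w : SobolevH10 Ω, ‖weakGrad (w : SobolevH1 Ω)‖ ≤ 1 ∧
      r = |weakDiv (fun x => Φ (g x)) w|} := by
    refine ⟨‖superposition hΦ g‖, ?_⟩
    rintro r ⟨z, hz, rfl⟩
    rw [weakDiv_eq_neg_inner_superposition hΦ, abs_neg]
    exact (abs_real_inner_le_norm _ _).trans (mul_le_of_le_one_right (norm_nonneg _) hz)
  rcases (norm_nonneg (weakGrad (w : SobolevH1 Ω))).eq_or_lt with h0 | h0
  · rw [← h0, mul_zero, weakDiv_eq_neg_inner_superposition hΦ, norm_eq_zero.1 h0.symm]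
    simp
  -- Normalize: `t⁻¹ • w` is admissible in the supremum.
  · set t := ‖weakGrad (w : SobolevH1 Ω)‖ with ht
    have hgrad : weakGrad ((t⁻¹ • w : SobolevH10 Ω) : SobolevH1 Ω)
        = t⁻¹ • weakGrad (w : SobolevH1 Ω) := rfl
    have h := le_csSup hbdd ⟨t⁻¹ • w, by
      rw [hgrad, norm_smul, ← ht, Real.norm_of_nonneg (by positivity), inv_mul_cancel₀ h0.ne'],
      rfl⟩
    rw [weakDiv_eq_neg_inner_superposition hΦ, hgrad, inner_smul_right, ← mul_neg, abs_mul,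
      abs_of_pos (inv_pos.2 h0), ← weakDiv_eq_neg_inner_superposition hΦ,
      inv_mul_le_iff₀ h0, mul_comm] at h
    exact h

/-! ### Existence and the error estimate -/

/-- Existence of weak solutions in `u₀ + H¹₀(Ω)`. -/
theorem exists_isWeakSolution (hΦ : LipschitzWith K Φ) (hN : 1 ≤ N) {R c : ℝ} (hc : 0 < c)
    (hR : ∀ x ∈ Ω, ‖x‖ ≤ R)
    (hmono : ∀ a₁ a₀, c * ‖a₁ - a₀‖ ^ 2 ≤ ⟪Φ a₁ - Φ a₀, a₁ - a₀⟫) (u₀ : SobolevH1 Ω) :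
    ∃ u : SobolevH1 Ω, u - u₀ ∈ SobolevH10 Ω ∧ IsWeakSolution Φ u := by
  have hP : 0 < 4 * R ^ 2 + 1 := by positivity
  obtain ⟨w, hwW, hw⟩ := exists_mem_inner_map_eq_zero (weakGradL Ω) (SobolevH10 Ω)
    (Submodule.isClosed_topologicalClosure _) (superposition hΦ) (weakGrad u₀) hc hP K.2
    (norm_superposition_sub_le hΦ) (le_inner_superposition_sub hΦ hmono)
    (fun w hw => norm_sq_le_weakGrad_of_mem_SobolevH10 hN hR hw)
  have hmem : (u₀ + w) - u₀ ∈ SobolevH10 Ω := by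
    rw [add_sub_cancel_left]
    exact hwW
  refine ⟨u₀ + w, hmem, fun z => ?_⟩
  rw [weakDiv_eq_neg_inner_superposition hΦ, neg_eq_zero]
  exact hw z z.2

/-- The `H⁻¹` norm of the residual of `v` controls the distance to a weak solution. -/
theorem norm_sub_sq_le_errorFunctional (hΦ : LipschitzWith K Φ) (hN : 1 ≤ N) {R c : ℝ}
    (hc : 0 < c) (hR : ∀ x ∈ Ω, ‖x‖ ≤ R)
    (hmono : ∀ a₁ a₀, c * ‖a₁ - a₀‖ ^ 2 ≤ ⟪Φ a₁ - Φ a₀, a₁ - a₀⟫) {u v : SobolevH1 Ω}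
    (hu : IsWeakSolution Φ u) (huv : u - v ∈ SobolevH10 Ω) :
    ‖u - v‖ ^ 2 ≤ 2 * (4 * R ^ 2 + 1) / c ^ 2 * errorFunctional Φ v := by
  set h := hMinusOneNorm (weakDiv (Ω := Ω) (fun x => Φ (weakGrad v x))) with hh
  have hd : weakGrad (u - v) = weakGrad u - weakGrad v := rfl
  have h1 := le_inner_superposition_sub hΦ hmono (weakGrad u) (weakGrad v)
  have h2 := hu ⟨u - v, huv⟩
  have h3 := (le_abs_self _).trans
    (abs_weakDiv_le_hMinusOneNorm_mul hΦ (weakGrad v) ⟨u - v, huv⟩)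
  rw [weakDiv_eq_neg_inner_superposition hΦ, neg_eq_zero] at h2
  rw [weakDiv_eq_neg_inner_superposition hΦ] at h3
  -- The equation for `u`, tested with `u - v`, removes the `Φ(∇u)` term and leaves only the
  -- residual of `v`.
  rw [inner_sub_left, ← hd, h2, zero_sub] at h1
  have h4 : c * ‖weakGrad (u - v)‖ ^ 2 ≤ h * ‖weakGrad (u - v)‖ := h1.trans h3
  have h5 : (c * ‖weakGrad (u - v)‖) ^ 2 ≤ h ^ 2 := by
    rcases (norm_nonneg (weakGrad (u - v))).eq_or_lt with h0 | h0
    · rw [← h0]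
      simpa using sq_nonneg h
    · refine pow_le_pow_left₀ (by positivity) (le_of_mul_le_mul_right ?_ h0) 2
      linarith
  refine (norm_sq_le_weakGrad_of_mem_SobolevH10 hN hR huv).trans ?_
  rw [errorFunctional, ← hh]
  have h6 : 2 * (4 * R ^ 2 + 1) / c ^ 2 * (1 / 2 * h ^ 2) = (4 * R ^ 2 + 1) * (h ^ 2 / c ^ 2) := by
    field_simp
  rw [h6]
  gcongr
  rw [le_div_iff₀' (by positivity), ← mul_pow]
  exact h5

end Superposition

end

/-! ### The theorem -/

theorem mainTheorem7 {N : ℕ} (hN : 1 ≤ N) {Ω : Set (RN N)} (hΩ : IsOpen Ω)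
    (hΩb : Bornology.IsBounded Ω) {c : ℝ} (hc : 0 < c) :
    ∃ C : ℝ, 0 < C ∧
      ∀ (Φ : RN N → RN N) (M : ℝ), ContDiff ℝ 2 Φ → (∀ a, ‖fderiv ℝ Φ a‖ ≤ M) →
        (∀ a₁ a₀, c * ‖a₁ - a₀‖ ^ 2 ≤ ⟪Φ a₁ - Φ a₀, a₁ - a₀⟫) →
        ∀ u₀ : SobolevH1 Ω, ∃ u : SobolevH1 Ω,
          (u - u₀ ∈ SobolevH10 Ω ∧ IsWeakSolution Φ u) ∧
          (∀ u' : SobolevH1 Ω, u' - u₀ ∈ SobolevH10 Ω → IsWeakSolution Φ u' → u' = u) ∧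
          ∀ v : SobolevH1 Ω, v - u₀ ∈ SobolevH10 Ω →
            ‖u - v‖ ^ 2 ≤ C * errorFunctional Φ v := by
  obtain ⟨R, hR⟩ := hΩb.exists_norm_le
  have : IsFiniteMeasure (volume.restrict Ω) :=
    isFiniteMeasure_restrict.2 hΩb.measure_lt_top.ne
  refine ⟨2 * (4 * R ^ 2 + 1) / c ^ 2, by positivity, fun Φ M hΦ hM hmono u₀ => ?_⟩
  have hLip : LipschitzWith M.toNNReal Φ :=
    lipschitzWith_of_nnnorm_fderiv_le (hΦ.differentiable (by simp)) fun a => by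
      rw [← NNReal.coe_le_coe, coe_nnnorm]
      exact (hM a).trans (Real.le_coe_toNNReal M)
  obtain ⟨u, hu, hsol⟩ := exists_isWeakSolution hLip hN hc hR hmono u₀
  refine ⟨u, ⟨hu, hsol⟩, fun u' hu' hsol' => ?_, fun v hv => ?_⟩
  · have huu : u - u' ∈ SobolevH10 Ω := by simpa using sub_mem hu hu'
    -- A second solution has zero residual, so the error estimate with `v = u'` forces `u' = u`.
    have hE : errorFunctional Φ u' = 0 := by
      have hset : {r : ℝ | ∃ w : SobolevH10 Ω, ‖weakGrad (w : SobolevH1 Ω)‖ ≤ 1 ∧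
          r = |weakDiv (fun x => Φ (weakGrad u' x)) w|} = {0} := by
        ext r
        simp only [hsol' _, abs_zero, Set.mem_ofPred_eq, Set.mem_singleton_iff]
        refine ⟨fun ⟨_, _, h⟩ => h, fun h => ⟨0, ?_, h⟩⟩
        rw [show weakGrad ((0 : SobolevH10 Ω) : SobolevH1 Ω) = 0 from rfl, norm_zero]
        exact zero_le_one
      rw [errorFunctional, hMinusOneNorm, hset, csSup_singleton]
      simp
    have h := norm_sub_sq_le_errorFunctional hLip hN hc hR hmono hsol huu
    rw [hE, mul_zero] at h
    have h0 : ‖u - u'‖ = 0 := pow_eq_zero_iff two_ne_zero |>.1 (le_antisymm h (sq_nonneg _))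
    exact (sub_eq_zero.1 (norm_eq_zero.1 h0)).symm
  · exact norm_sub_sq_le_errorFunctional hLip hN hc hR hmono hsol
      (by simpa using sub_mem hu hv)
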